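/- Let $n\ge 2$, $s\in(0,1)$ and $p,q\in(1,\infty)$ satisfy $0<\frac1p-\frac1q<\frac sn$. Then there is a constant $c_{s,n,p,q}>0$, depending only on $s,n,p,q$, such that the following holds for every $\eta\ge 1$ and every bounded domain (nonempty connected open set) $\Omega\subset\mathbb{R}^n$ whose complement $A=\mathbb{R}^n\setminus\Omega$ is $\eta$-plump, i.e. for all $x\in\overline{A}$ and all $r\in(0,\operatorname{diam}(A))$ there is a point $z\in\overline{B^n(x,r)}$ with $B^n(z,r/\eta)\subset A$. Let $\widetilde B^s_{pp}(\overline\Omega)$ be the space of all $u:\mathbb{R}^n\to\mathbb{C}$ (up to equality almost everywhere) in $W^{s,p}(\mathbb{R}^n)$ with $\operatorname{spt}u\subset\overline\Omega$, where $W^{s,p}(\mathbb{R}^n)$ is the space of all $u\in L^p(\mathbb{R}^n)$ with finite norm $$\|u\|_{W^{s,p}(\mathbb{R}^n)}=\|u\|_{L^p(\mathbb{R}^n)}+\biggl(\int_{\mathbb{R}^n}\int_{\mathbb{R}^n}\frac{|u(x)-u(y)|^p}{|x-y|^{sp+n}}\,dx\,dy\biggr)^{1/p},$$ and put $\|u\|_{\widetilde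 B^s_{pp}(\overline\Omega)}=\|u\|_{W^{s,p}(\mathbb{R}^n)}$. Then $$\biggl(\int_\Omega\frac{|u(x)|^q}{\operatorname{dist}(x,\partial\Omega)^{sq+n(1-q/p)}}\,dx\biggr)^{1/q}\le c_{s,n,p,q}\,\eta^{2n/q+s-n/p}\,\|u\|_{\widetilde B^s_{pp}(\overline\Omega)}$$ for every $u\in\widetilde B^s_{pp}(\overline\Omega)$. -/

import Mathlib

open MeasureTheory
open scoped ENNReal

/-- `A` is `η`-plump: for all `x ∈ closure A` and `0 < r < diam A` there is `z` in the closed ball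
`B(x, r)` with the open ball `B(z, r / η)` contained in `A`. The diameter takes values in `[0, ∞]`,
so for unbounded `A` every `r > 0` is allowed. -/
def IsPlump {n : ℕ} (η : ℝ) (A : Set (EuclideanSpace ℝ (Fin n))) : Prop :=
  ∀ x ∈ closure A, ∀ r : ℝ, 0 < r → ENNReal.ofReal r < Metric.ediam A →
    ∃ z ∈ Metric.closedBall x r, Metric.ball z (r / η) ⊆ A

/-- The seminorm
`|u|_{W^{s,p}(ℝⁿ)} = (∫_{ℝⁿ} ∫_{ℝⁿ} |u(x) - u(y)|^p / |x - y|^{sp+n} dx dy)^{1/p}` in `[0, ∞]`. -/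
noncomputable def fracSobolevSeminorm {n : ℕ} (s p : ℝ) (u : EuclideanSpace ℝ (Fin n) → ℂ) :
    ℝ≥0∞ :=
  (∫⁻ y, ∫⁻ x, ‖u x - u y‖ₑ ^ p / ‖x - y‖ₑ ^ (s * p + n)) ^ (1 / p)

/-- The norm `‖u‖_{W^{s,p}(ℝⁿ)} = ‖u‖_{L^p(ℝⁿ)} + |u|_{W^{s,p}(ℝⁿ)}` in `[0, ∞]`. -/
noncomputable def fracSobolevNorm {n : ℕ} (s p : ℝ) (u : EuclideanSpace ℝ (Fin n) → ℂ) : ℝ≥0∞ :=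
  eLpNorm u (ENNReal.ofReal p) volume + fracSobolevSeminorm s p u

/-- `u ∈ W^{s,p}(ℝⁿ)`: `u ∈ L^p(ℝⁿ)` and `‖u‖_{W^{s,p}(ℝⁿ)} < ∞`. -/
def MemFracSobolev {n : ℕ} (s p : ℝ) (u : EuclideanSpace ℝ (Fin n) → ℂ) : Prop :=
  MemLp u (ENNReal.ofReal p) volume ∧ fracSobolevNorm s p u < ∞

/-- `u ∈ B̃^s_{pp}(closure Ω)`: `u ∈ W^{s,p}(ℝⁿ)` and `spt u ⊆ closure Ω`, where `spt` is the
closure of the set where the function is nonzero. As elements of `L^p` are functions up to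
equality almost everywhere, it suffices that one representative of `u` has its support there. -/
def MemBesovTilde {n : ℕ} (s p : ℝ) (Ω : Set (EuclideanSpace ℝ (Fin n)))
    (u : EuclideanSpace ℝ (Fin n) → ℂ) : Prop :=
  MemFracSobolev s p u ∧ ∃ v : EuclideanSpace ℝ (Fin n) → ℂ, v =ᵐ[volume] u ∧
    tsupport v ⊆ closure Ω

/-- The norm of `B̃^s_{pp}(closure Ω)`, which is the norm of `W^{s,p}(ℝⁿ)`. -/
noncomputable def besovTildeNorm {n : ℕ} (s p : ℝ) (u : EuclideanSpace ℝ (Fin n) → ℂ) : ℝ≥0∞ :=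
  fracSobolevNorm s p u

/-! Put `κ = p / q`, `θ = s - n / p + n / q` and `d = dist(x, ∂Ω)`. Let `g(x)` be the `p`-th root of
`gagliardo s p u x` and `W` the `W^{s,p}` seminorm. The inequality follows from a pointwise
interpolation bound (`exists_forall_norm_le`): `|u(x)|` is at most a constant times `η^E d^θ g(x)^κ
W^(1-κ)`, where `E = n κ / p + θ` is the required power of `η`. Its `q`-th power divided by `d^(θ
q)` is at most a constant times `g(x)^p W^(q-p)`, whose integral is `W^q`.

The pointwise bound balances two estimates. Plumpness gives a ball `B(z, d/η)` outside `Ω`, where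
`u` has mean zero; comparing `u(x)` with that mean gives the Hardy bound `η^(n/p) d^s g(x)`. The
other estimate also uses `W`. If `s p < n`, means over doubling balls telescope to zero at infinity,
so `|u(x)|` is bounded by `r^s g(x) + r^(s-n/p) W` for every `r > 0`. If `s p ≥ n`, this sum need
not converge; instead a chain of balls leads from `x` to `B(z, d/η)`. Passing between concentric
balls in `N` equal-ratio steps replaces the loss `(ratio)^(n/p)` by `(ratio)^(n/(pN))`, and a large
`N` keeps the power of `η` within `E`. -/

/-- Jensen's inequality for powers of nonnegative functions on a probability space. -/
theorem lintegral_rpow_le_lintegral_rpow {α : Type*} [MeasurableSpace α] {μ : Measure α}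
    [IsProbabilityMeasure μ] {f : α → ℝ≥0∞} (hf : AEMeasurable f μ) {p : ℝ} (hp : 1 ≤ p) :
    (∫⁻ x, f x ∂μ) ^ p ≤ ∫⁻ x, f x ^ p ∂μ := by
  have hp0 : 0 < p := by linarith
  have h := eLpNorm'_le_eLpNorm'_of_exponent_le (μ := μ) (f := f) one_pos hp hf.aestronglyMeasurable
  simp only [eLpNorm', enorm_eq_self, ENNReal.rpow_one, div_one] at h
  calc (∫⁻ x, f x ∂μ) ^ p ≤ ((∫⁻ x, f x ^ p ∂μ) ^ (1 / p)) ^ p := by gcongr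
    _ = _ := by rw [← ENNReal.rpow_mul, one_div_mul_cancel hp0.ne', ENNReal.rpow_one]

/-- A difference of means is the double mean of the differences, so Jensen applies once in each
variable. -/
theorem enorm_integral_sub_integral_rpow_le {α : Type*} [MeasurableSpace α] {μ ν : Measure α}
    [IsProbabilityMeasure μ] [IsProbabilityMeasure ν] {u : α → ℂ} (hu : Measurable u)
    (hμ : Integrable u μ) (hν : Integrable u ν) {p : ℝ} (hp : 1 ≤ p) :
    ‖∫ y, u y ∂μ - ∫ z, u z ∂ν‖ₑ ^ p ≤ ∫⁻ y, ∫⁻ z, ‖u y - u z‖ₑ ^ p ∂ν ∂μ := by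
  have hm : Measurable (Function.uncurry fun y z => ‖u y - u z‖ₑ) := by
    simp only [Function.uncurry_def]; fun_prop
  have h1 : ∫ y, u y ∂μ - ∫ z, u z ∂ν = ∫ y, ∫ z, (u y - u z) ∂ν ∂μ := by
    have : ∀ y, ∫ z, (u y - u z) ∂ν = u y - ∫ z, u z ∂ν := fun y => by
      rw [integral_sub (integrable_const _) hν]; simp
    simp_rw [this]
    rw [integral_sub hμ (integrable_const _)]; simp
  calc ‖∫ y, u y ∂μ - ∫ z, u z ∂ν‖ₑ ^ p ≤ (∫⁻ y, ∫⁻ z, ‖u y - u z‖ₑ ∂ν ∂μ) ^ p := by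
        gcongr
        rw [h1]
        refine (enorm_integral_le_lintegral_enorm _).trans (lintegral_mono fun y => ?_)
        exact enorm_integral_le_lintegral_enorm _
    _ ≤ ∫⁻ y, (∫⁻ z, ‖u y - u z‖ₑ ∂ν) ^ p ∂μ :=
        lintegral_rpow_le_lintegral_rpow hm.lintegral_prod_right.aemeasurable hp
    _ ≤ _ := lintegral_mono fun y =>
        lintegral_rpow_le_lintegral_rpow (by fun_prop) hp

/-! ### Gagliardo quotients and means over balls -/

section
variable {n : ℕ} {s p : ℝ} {u : EuclideanSpace ℝ (Fin n) → ℂ}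

/-- The `p`-th power of the local Gagliardo difference quotient of `u` at `x`. -/
noncomputable def gagliardo (s p : ℝ) (u : EuclideanSpace ℝ (Fin n) → ℂ)
    (x : EuclideanSpace ℝ (Fin n)) : ℝ≥0∞ :=
  ∫⁻ y, ‖u x - u y‖ₑ ^ p / ‖x - y‖ₑ ^ (s * p + n)

/-- The mean value of `u` over the ball `B(c, r)`. -/
noncomputable def ballMean (u : EuclideanSpace ℝ (Fin n) → ℂ) (c : EuclideanSpace ℝ (Fin n))
    (r : ℝ) : ℂ :=
  ∫ y, u y ∂(ProbabilityTheory.cond volume (Metric.ball c r))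

theorem measurable_gagliardo (hu : Measurable u) : Measurable (gagliardo s p u) := by
  unfold gagliardo
  apply Measurable.lintegral_prod_right'
    (f := fun z : EuclideanSpace ℝ (Fin n) × EuclideanSpace ℝ (Fin n) =>
      ‖u z.1 - u z.2‖ₑ ^ p / ‖z.1 - z.2‖ₑ ^ (s * p + n))
  fun_prop

theorem isProbabilityMeasure_cond_ball (c : EuclideanSpace ℝ (Fin n)) {r : ℝ} (hr : 0 < r) :
    IsProbabilityMeasure (ProbabilityTheory.cond volume (Metric.ball c r)) :=
  ProbabilityTheory.cond_isProbabilityMeasure_of_finite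
    (Metric.measure_ball_pos volume c hr).ne' measure_ball_lt_top.ne

theorem lintegral_cond_ball (c : EuclideanSpace ℝ (Fin n)) (r : ℝ)
    (f : EuclideanSpace ℝ (Fin n) → ℝ≥0∞) :
    ∫⁻ y, f y ∂(ProbabilityTheory.cond volume (Metric.ball c r)) =
      (volume (Metric.ball c r))⁻¹ * ∫⁻ y in Metric.ball c r, f y := by
  simp [ProbabilityTheory.cond, lintegral_smul_measure]

theorem integrable_cond_ball (hu : LocallyIntegrable u volume) (c : EuclideanSpace ℝ (Fin n))
    {r : ℝ} (hr : 0 < r) :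
    Integrable u (ProbabilityTheory.cond volume (Metric.ball c r)) := by
  refine Integrable.smul_measure ?_
    (ENNReal.inv_ne_top.2 (Metric.measure_ball_pos volume c hr).ne')
  exact (hu.integrableOn_isCompact (isCompact_closedBall c r)).mono_set Metric.ball_subset_closedBall

/-- This inserts the Gagliardo kernel at the price of the diameter bound `D`. On the diagonal the
left side vanishes because `p > 0`. -/
theorem enorm_sub_rpow_le_mul_div {x y : EuclideanSpace ℝ (Fin n)} {D : ℝ} (hs : 0 < s)
    (hp : 1 ≤ p) (hD : ‖x - y‖ ≤ D) :
    ‖u x - u y‖ₑ ^ p ≤ ENNReal.ofReal D ^ (s * p + n) *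
      (‖u x - u y‖ₑ ^ p / ‖x - y‖ₑ ^ (s * p + n)) := by
  have he : 0 < s * p + n := by positivity
  rcases eq_or_ne x y with rfl | hxy
  · simp [ENNReal.zero_rpow_of_pos (show 0 < p by linarith)]
  have h0 : ‖x - y‖ₑ ≠ 0 := by simpa [sub_eq_zero] using hxy
  have h1 : ‖x - y‖ₑ ≤ ENNReal.ofReal D := by
    rw [← ofReal_norm]; exact ENNReal.ofReal_le_ofReal hD
  calc ‖u x - u y‖ₑ ^ p = ‖x - y‖ₑ ^ (s * p + n) *
      (‖u x - u y‖ₑ ^ p / ‖x - y‖ₑ ^ (s * p + n)) := by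
        rw [ENNReal.mul_div_cancel]
        · exact (ENNReal.rpow_pos (pos_iff_ne_zero.2 h0) enorm_ne_top).ne'
        · exact ENNReal.rpow_ne_top_of_nonneg he.le enorm_ne_top
    _ ≤ _ := by gcongr

theorem enorm_sub_ballMean_rpow_le (hu : Measurable u) (hloc : LocallyIntegrable u volume)
    (hs : 0 < s) (hp : 1 ≤ p) (x c : EuclideanSpace ℝ (Fin n)) {r D : ℝ} (hr : 0 < r)
    (hD : ∀ y ∈ Metric.ball c r, ‖x - y‖ ≤ D) :
    ‖u x - ballMean u c r‖ₑ ^ p ≤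
      ENNReal.ofReal D ^ (s * p + n) * (volume (Metric.ball c r))⁻¹ * gagliardo s p u x := by
  have := isProbabilityMeasure_cond_ball c hr
  -- A point value is the mean against a Dirac mass.
  have h := enorm_integral_sub_integral_rpow_le (μ := Measure.dirac x) hu
    (integrable_dirac (by simp)) (integrable_cond_ball hloc c hr) hp
  rw [integral_dirac, lintegral_dirac, lintegral_cond_ball] at h
  refine h.trans ?_
  rw [mul_comm (ENNReal.ofReal D ^ _), mul_assoc]
  gcongr
  calc _ ≤ ∫⁻ y in Metric.ball c r, ENNReal.ofReal D ^ (s * p + n) *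
      (‖u x - u y‖ₑ ^ p / ‖x - y‖ₑ ^ (s * p + n)) :=
        setLIntegral_mono' measurableSet_ball fun y hy =>
          enorm_sub_rpow_le_mul_div hs hp (hD y hy)
    _ ≤ ∫⁻ y, ENNReal.ofReal D ^ (s * p + n) *
      (‖u x - u y‖ₑ ^ p / ‖x - y‖ₑ ^ (s * p + n)) := setLIntegral_le_lintegral _ _
    _ = _ := by rw [lintegral_const_mul _ (by fun_prop)]; rfl

theorem enorm_ballMean_sub_ballMean_rpow_le (hu : Measurable u)
    (hloc : LocallyIntegrable u volume) (hs : 0 < s) (hp : 1 ≤ p)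
    (a c : EuclideanSpace ℝ (Fin n)) {ρ r D : ℝ} (hρ : 0 < ρ) (hr : 0 < r)
    (hD : ∀ x ∈ Metric.ball a ρ, ∀ y ∈ Metric.ball c r, ‖x - y‖ ≤ D) :
    ‖ballMean u a ρ - ballMean u c r‖ₑ ^ p ≤
      ENNReal.ofReal D ^ (s * p + n) * (volume (Metric.ball a ρ))⁻¹ *
        (volume (Metric.ball c r))⁻¹ * ∫⁻ x, gagliardo s p u x := by
  have := isProbabilityMeasure_cond_ball a hρ
  have := isProbabilityMeasure_cond_ball c hr
  refine (enorm_integral_sub_integral_rpow_le hu (integrable_cond_ball hloc a hρ)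
    (integrable_cond_ball hloc c hr) hp).trans ?_
  simp_rw [lintegral_cond_ball]
  calc _ ≤ (volume (Metric.ball a ρ))⁻¹ * ∫⁻ x in Metric.ball a ρ,
        (volume (Metric.ball c r))⁻¹ * (ENNReal.ofReal D ^ (s * p + n) * gagliardo s p u x) := by
        refine mul_le_mul' le_rfl ?_
        refine setLIntegral_mono' measurableSet_ball fun x hx => ?_
        refine mul_le_mul' le_rfl ?_
        calc _ ≤ ∫⁻ y in Metric.ball c r, ENNReal.ofReal D ^ (s * p + n) *
            (‖u x - u y‖ₑ ^ p / ‖x - y‖ₑ ^ (s * p + n)) :=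
              setLIntegral_mono' measurableSet_ball fun y hy =>
                enorm_sub_rpow_le_mul_div hs hp (hD x hx y hy)
          _ ≤ ∫⁻ y, ENNReal.ofReal D ^ (s * p + n) *
            (‖u x - u y‖ₑ ^ p / ‖x - y‖ₑ ^ (s * p + n)) := setLIntegral_le_lintegral _ _
          _ = _ := by rw [lintegral_const_mul _ (by fun_prop)]; rfl
    _ ≤ (volume (Metric.ball a ρ))⁻¹ * ∫⁻ x,
        (volume (Metric.ball c r))⁻¹ * (ENNReal.ofReal D ^ (s * p + n) * gagliardo s p u x) := by
        refine mul_le_mul' le_rfl ?_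
        exact setLIntegral_le_lintegral _ _
    _ = _ := by
        have := measurable_gagliardo (s := s) (p := p) hu
        rw [lintegral_const_mul _ (by fun_prop), lintegral_const_mul _ (by fun_prop)]
        ring

theorem ballMean_eq_zero {c : EuclideanSpace ℝ (Fin n)} {r : ℝ}
    (h : ∀ᵐ y ∂volume, y ∈ Metric.ball c r → u y = 0) : ballMean u c r = 0 := by
  refine integral_eq_zero_of_ae ?_
  have h' : u =ᵐ[volume.restrict (Metric.ball c r)] 0 :=
    (ae_restrict_iff' measurableSet_ball).2 h
  exact Measure.ae_smul_measure h' _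

theorem enorm_ballMean_rpow_le (hu : Measurable u) (hp : 1 ≤ p) (c : EuclideanSpace ℝ (Fin n)) {r : ℝ} (hr : 0 < r) :
    ‖ballMean u c r‖ₑ ^ p ≤ (volume (Metric.ball c r))⁻¹ * ∫⁻ x, ‖u x‖ₑ ^ p := by
  have := isProbabilityMeasure_cond_ball c hr
  calc _ ≤ (∫⁻ x, ‖u x‖ₑ ∂(ProbabilityTheory.cond volume (Metric.ball c r))) ^ p := by
        gcongr; exact enorm_integral_le_lintegral_enorm _
    _ ≤ _ := lintegral_rpow_le_lintegral_rpow (by fun_prop) hp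
    _ ≤ _ := by
        rw [lintegral_cond_ball]
        refine mul_le_mul' le_rfl ?_
        exact setLIntegral_le_lintegral _ _

/-- The volume of the unit ball. -/
noncomputable def unitBallVolume (n : ℕ) : ℝ :=
  (volume (Metric.ball (0 : EuclideanSpace ℝ (Fin n)) 1)).toReal

theorem unitBallVolume_pos (n : ℕ) : 0 < unitBallVolume n :=
  ENNReal.toReal_pos (Metric.measure_ball_pos volume _ one_pos).ne' measure_ball_lt_top.ne

theorem volume_ball_eq (c : EuclideanSpace ℝ (Fin n)) {r : ℝ} (hr : 0 < r) :
    volume (Metric.ball c r) = ENNReal.ofReal (unitBallVolume n * r ^ n) := by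
  rw [Measure.addHaar_ball_of_pos _ _ hr, unitBallVolume, mul_comm,
    ENNReal.ofReal_mul ENNReal.toReal_nonneg, ENNReal.ofReal_toReal measure_ball_lt_top.ne]
  simp

end

/-! ### Balancing the two estimates at the critical scale -/

/-- A Hardy-type bound for `a` settles the scales `d ≤ r / η`, where `r` is the scale at which
`w = γ * r ^ ν`; only the remaining scales need another bound. -/
theorem le_of_rescaled_le {a C η d γ w ν s κ θ : ℝ} (hC : 0 ≤ C) (hη : 1 ≤ η)
    (hd : 0 < d) (hγ : 0 ≤ γ) (hw : 0 < w) (ha : 0 ≤ a) (hν : 0 < ν) (hκ1 : κ < 1)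
    (hθ : θ = s - ν + ν * κ) (hθ0 : 0 < θ) (h1 : a ≤ C * (η ^ ν * d ^ s * γ))
    (h2 : ∀ r τ, 0 < r → 0 < τ → 0 < γ → 1 ≤ η * τ → w = γ * r ^ ν → d = τ * r →
      a ≤ 2 * C * (η ^ (ν * κ) * (η * τ) ^ θ * (r ^ s * γ))) :
    a ≤ 2 * C * (η ^ (ν * κ + θ) * d ^ θ * γ ^ κ * w ^ (1 - κ)) := by
  rcases hγ.eq_or_lt with rfl | hγ
  -- For `γ = 0` there is no critical scale, but the Hardy-type bound already forces `a = 0`.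
  · have : a = 0 := le_antisymm (by simpa using h1) ha
    rw [this]; positivity
  have hη0 : 0 < η := by linarith
  obtain ⟨r, hr, hwr⟩ : ∃ r : ℝ, 0 < r ∧ w = γ * r ^ ν := by
    refine ⟨(w / γ) ^ ν⁻¹, by positivity, ?_⟩
    rw [← Real.rpow_mul (by positivity), inv_mul_cancel₀ hν.ne', Real.rpow_one]
    field_simp
  obtain ⟨τ, hτ, hdτ⟩ : ∃ τ : ℝ, 0 < τ ∧ d = τ * r := ⟨d / r, by positivity, by field_simp⟩
  have hR : η ^ (ν * κ + θ) * d ^ θ * γ ^ κ * w ^ (1 - κ) =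
      η ^ (ν * κ) * (η * τ) ^ θ * (r ^ s * γ) := by
    rw [hwr, hdτ, Real.mul_rpow hτ.le hr.le, Real.mul_rpow hγ.le (by positivity),
      Real.mul_rpow hη0.le hτ.le, Real.rpow_add hη0, ← Real.rpow_mul hr.le]
    have e1 : r ^ s = r ^ θ * r ^ (ν * (1 - κ)) := by
      rw [← Real.rpow_add hr]; congr 1; rw [hθ]; ring
    have e2 : γ ^ κ * γ ^ (1 - κ) = γ := by
      rw [← Real.rpow_add hγ]; simp
    rw [e1]
    linear_combination (η ^ (ν * κ) * η ^ θ * τ ^ θ * r ^ θ * r ^ (ν * (1 - κ))) * e2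
  rw [hR]
  rcases le_total 1 (η * τ) with h | h
  · exact h2 r τ hr hτ hγ h hwr hdτ
  -- Here `η τ ≤ 1`. The Hardy bound exceeds the target only by factors that are powers of `η τ` and
  -- `τ ≤ η τ`, with nonnegative exponents.
  · have e : η ^ ν * d ^ s * γ =
        η ^ (ν * κ) * τ ^ θ * (η * τ) ^ (ν - ν * κ) * (r ^ s * γ) := by
      have e1 : η ^ ν = η ^ (ν * κ) * η ^ (ν - ν * κ) := by
        rw [← Real.rpow_add hη0]; congr 1; ring
      have e2 : τ ^ s = τ ^ θ * τ ^ (ν - ν * κ) := by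
        rw [← Real.rpow_add hτ]; congr 1; rw [hθ]; ring
      rw [hdτ, Real.mul_rpow hτ.le hr.le, Real.mul_rpow hη0.le hτ.le, e1, e2]
      ring
    have h3 : (η * τ) ^ (ν - ν * κ) ≤ 1 :=
      Real.rpow_le_one (by positivity) h (by nlinarith)
    have h4 : τ ^ θ ≤ (η * τ) ^ θ := by
      gcongr; nlinarith
    calc a ≤ C * (η ^ (ν * κ) * τ ^ θ * (η * τ) ^ (ν - ν * κ) * (r ^ s * γ)) := e ▸ h1
      _ ≤ C * (η ^ (ν * κ) * (η * τ) ^ θ * 1 * (r ^ s * γ)) := by gcongr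
      _ ≤ 2 * (C * (η ^ (ν * κ) * (η * τ) ^ θ * 1 * (r ^ s * γ))) :=
          le_mul_of_one_le_left (by positivity) one_le_two
      _ = _ := by ring

/-- Balancing two bounds for `a`: the case in which the scale `r` is free. -/
theorem le_of_forall_scale_le {a C η d γ w ν s κ θ : ℝ} (hC : 0 ≤ C) (hη : 1 ≤ η)
    (hd : 0 < d) (hγ : 0 ≤ γ) (hw : 0 < w) (ha : 0 ≤ a) (hν : 0 < ν) (hκ0 : 0 < κ) (hκ1 : κ < 1)
    (hθ : θ = s - ν + ν * κ) (hθ0 : 0 < θ) (h1 : a ≤ C * (η ^ ν * d ^ s * γ))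
    (h2 : ∀ r, 0 < r → a ≤ C * (r ^ s * γ + r ^ (s - ν) * w)) :
    a ≤ 2 * C * (η ^ (ν * κ + θ) * d ^ θ * γ ^ κ * w ^ (1 - κ)) := by
  refine le_of_rescaled_le hC hη hd hγ hw ha hν hκ1 hθ hθ0 h1
    fun r τ hr hτ hγ h hwr hdτ => ?_
  have h3 := h2 r hr
  -- The critical scale makes the two terms equal.
  have e : r ^ (s - ν) * w = r ^ s * γ := by
    rw [hwr, Real.rpow_sub hr]; field_simp
  rw [e] at h3
  have h5 : 1 ≤ η ^ (ν * κ) * (η * τ) ^ θ := one_le_mul_of_one_le_of_one_le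
    (Real.one_le_rpow hη (by positivity)) (Real.one_le_rpow h hθ0.le)
  calc a ≤ 2 * C * (1 * (r ^ s * γ)) := by linarith
    _ ≤ _ := by gcongr

/-- Balancing two bounds for `a`: the case in which the scale `d / t` is at most `d`. -/
theorem le_of_forall_small_scale_le {a C η d γ w ν s κ θ β : ℝ} (hC : 0 ≤ C) (hη : 1 ≤ η)
    (hd : 0 < d) (hγ : 0 ≤ γ) (hw : 0 < w) (ha : 0 ≤ a) (hν : 0 < ν) (hκ0 : 0 < κ) (hκ1 : κ < 1)
    (hs : 0 < s) (hθ : θ = s - ν + ν * κ) (hθ0 : 0 < θ) (hβθ : β ≤ θ)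
    (hβκ : β ≤ s * κ) (h1 : a ≤ C * (η ^ ν * d ^ s * γ))
    (h2 : ∀ t, 1 ≤ t →
      a ≤ C * ((d / t) ^ s * γ + η ^ β * t ^ β * d ^ (s - ν) * w)) :
    a ≤ 2 * C * (η ^ (ν * κ + θ) * d ^ θ * γ ^ κ * w ^ (1 - κ)) := by
  refine le_of_rescaled_le hC hη hd hγ hw ha hν hκ1 hθ hθ0 h1
    fun r τ hr hτ hγ h hwr hdτ => ?_
  have hη0 : 0 < η := by linarith
  have h3 : ∀ t, 1 ≤ t →
      a ≤ C * ((τ ^ s / t ^ s + η ^ β * t ^ β * τ ^ (s - ν)) * (r ^ s * γ)) := by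
    intro t ht
    convert h2 t ht using 2
    rw [hwr, hdτ, Real.div_rpow (by positivity) (by positivity), Real.mul_rpow hτ.le hr.le,
      Real.mul_rpow hτ.le hr.le, Real.rpow_sub hr]
    field_simp
  have hηκ : 1 ≤ η ^ (ν * κ) := Real.one_le_rpow hη (by positivity)
  have hηβ : η ^ β ≤ η ^ θ := Real.rpow_le_rpow_of_exponent_le hη hβθ
  have hη1 : 1 ≤ η ^ θ := Real.one_le_rpow hη hθ0.le
  suffices h4 : ∃ t, 1 ≤ t ∧ τ ^ s / t ^ s ≤ τ ^ θ ∧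
      η ^ β * t ^ β * τ ^ (s - ν) ≤ η ^ (ν * κ) * (η ^ θ * τ ^ θ) by
    obtain ⟨t, ht, h5, h6⟩ := h4
    have h7 : τ ^ θ ≤ η ^ (ν * κ) * (η ^ θ * τ ^ θ) := by
      rw [← mul_assoc]
      exact le_mul_of_one_le_left (by positivity) (one_le_mul_of_one_le_of_one_le hηκ hη1)
    rw [Real.mul_rpow hη0.le hτ.le]
    calc a ≤ _ := h3 t ht
      _ ≤ C * ((η ^ (ν * κ) * (η ^ θ * τ ^ θ) + η ^ (ν * κ) * (η ^ θ * τ ^ θ)) * (r ^ s * γ)) := by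
        gcongr; exact h5.trans h7
      _ = _ := by ring
  have hδ : 0 < ν - ν * κ := by nlinarith
  rcases le_total τ 1 with hτ1 | hτ1
  -- For `τ ≤ 1` the scale `d` itself is enough: `θ ≤ s` handles the first term, and `(η τ)^(ν κ) ≥
  -- 1` pays for the second.
  · refine ⟨1, le_rfl, ?_, ?_⟩
    · rw [Real.one_rpow, div_one]
      exact Real.rpow_le_rpow_of_exponent_ge hτ hτ1 (by linarith)
    · have e : τ ^ θ = τ ^ (s - ν) * τ ^ (ν * κ) := by rw [← Real.rpow_add hτ, hθ]
      have h8 : 1 ≤ η ^ (ν * κ) * τ ^ (ν * κ) := by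
        rw [← Real.mul_rpow hη0.le hτ.le]; exact Real.one_le_rpow h (by positivity)
      rw [Real.one_rpow, mul_one, e]
      calc η ^ β * τ ^ (s - ν) ≤ η ^ θ * τ ^ (s - ν) := by gcongr
        _ ≤ (η ^ (ν * κ) * τ ^ (ν * κ)) * (η ^ θ * τ ^ (s - ν)) :=
            le_mul_of_one_le_left (by positivity) h8
        _ = _ := by ring
  -- This `t` solves `τ^s / t^s = τ^θ`; then `β ≤ s κ` keeps the power of `τ` in the second term at
  -- most `θ`.
  · refine ⟨τ ^ ((ν - ν * κ) / s), Real.one_le_rpow hτ1 (by positivity), ?_, ?_⟩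
    · rw [← Real.rpow_mul hτ.le, div_mul_cancel₀ _ hs.ne', ← Real.rpow_sub hτ]
      exact Real.rpow_le_rpow_of_exponent_le hτ1 (by linarith)
    · rw [← Real.rpow_mul hτ.le, mul_assoc, ← Real.rpow_add hτ]
      have h9 : (ν - ν * κ) / s * β + (s - ν) ≤ θ := by
        have : (ν - ν * κ) / s * β ≤ (ν - ν * κ) / s * (s * κ) := by gcongr
        have e : (ν - ν * κ) / s * (s * κ) = (ν - ν * κ) * κ := by field_simp
        nlinarith [mul_pos hν hκ0, mul_pos (mul_pos hν hκ0) hκ0]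
      calc η ^ β * τ ^ ((ν - ν * κ) / s * β + (s - ν)) ≤ η ^ θ * τ ^ θ := by
            gcongr
        _ ≤ _ := le_mul_of_one_le_left (by positivity) hηκ

/-! ### Real-valued estimates for means -/

/-- Extracts the `p`-th root; `ω * r ^ m` plays the role of the volume of a ball. -/
theorem le_of_rpow_le {A D ω r G s p m : ℝ} (hA : 0 ≤ A) (hD : 0 ≤ D) (hω : 0 < ω) (hr : 0 < r)
    (hG : 0 ≤ G) (hp : 0 < p) (h : A ^ p ≤ D ^ (s * p + m) * (ω * r ^ m)⁻¹ * G) :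
    A ≤ ω ^ (-(1 / p)) * D ^ (s + m / p) * r ^ (-(m / p)) * G ^ (1 / p) := by
  rw [← Real.rpow_le_rpow_iff hA (by positivity) hp]
  convert h using 1
  rw [Real.mul_rpow (by positivity) (by positivity), Real.mul_rpow (by positivity) (by positivity),
    Real.mul_rpow (by positivity) (by positivity), ← Real.rpow_mul hω.le, ← Real.rpow_mul hD,
    ← Real.rpow_mul hr.le, ← Real.rpow_mul hG, mul_inv, ← Real.rpow_neg_one ω,
    ← Real.rpow_neg hr.le, show -(1 / p) * p = -1 by field_simp,
    show (s + m / p) * p = s * p + m by field_simp, show -(m / p) * p = -m by field_simp,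
    show 1 / p * p = 1 by field_simp, Real.rpow_one]
  ring

section
variable {n : ℕ} {s p : ℝ} {u : EuclideanSpace ℝ (Fin n) → ℂ}

theorem norm_sub_ballMean_le (hu : Measurable u) (hloc : LocallyIntegrable u volume)
    (hs : 0 < s) (hp : 1 ≤ p) (x c : EuclideanSpace ℝ (Fin n)) {r D : ℝ} (hr : 0 < r)
    (hD0 : 0 ≤ D) (hD : ∀ y ∈ Metric.ball c r, ‖x - y‖ ≤ D) (hG : gagliardo s p u x ≠ ∞) :
    ‖u x - ballMean u c r‖ ≤ unitBallVolume n ^ (-(1 / p)) * D ^ (s + n / p) * r ^ (-(n / p)) *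
      (gagliardo s p u x).toReal ^ (1 / p) := by
  have hω := unitBallVolume_pos n
  refine le_of_rpow_le (norm_nonneg _) hD0 hω hr ENNReal.toReal_nonneg (by linarith) ?_
  have h := enorm_sub_ballMean_rpow_le hu hloc hs hp x c hr hD
  rw [volume_ball_eq c hr, ← ENNReal.ofReal_inv_of_pos (by positivity),
    ENNReal.ofReal_rpow_of_nonneg hD0 (by positivity), ← ENNReal.ofReal_mul (by positivity)] at h
  have := ENNReal.toReal_mono (ENNReal.mul_ne_top ENNReal.ofReal_ne_top hG) h
  rw [ENNReal.toReal_mul, ENNReal.toReal_ofReal (by positivity), ← ENNReal.toReal_rpow,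
    toReal_enorm] at this
  simpa only [Real.rpow_natCast] using this

theorem norm_ballMean_sub_ballMean_le (hu : Measurable u) (hloc : LocallyIntegrable u volume)
    (hs : 0 < s) (hp : 1 ≤ p) (a c : EuclideanSpace ℝ (Fin n)) {ρ r D : ℝ} (hρ : 0 < ρ)
    (hr : 0 < r) (hD0 : 0 ≤ D) (hD : ∀ x ∈ Metric.ball a ρ, ∀ y ∈ Metric.ball c r, ‖x - y‖ ≤ D)
    (hW : ∫⁻ x, gagliardo s p u x ≠ ∞) :
    ‖ballMean u a ρ - ballMean u c r‖ ≤ (unitBallVolume n ^ (-(1 / p))) ^ 2 * D ^ (s + n / p) *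
      ρ ^ (-(n / p)) * r ^ (-(n / p)) * (∫⁻ x, gagliardo s p u x).toReal ^ (1 / p) := by
  have hω := unitBallVolume_pos n
  have hp0 : 0 < p := by linarith
  -- The inverse volume of the first ball is absorbed into the factor `G` of `le_of_rpow_le`.
  have key : ‖ballMean u a ρ - ballMean u c r‖ ≤ unitBallVolume n ^ (-(1 / p)) *
      D ^ (s + n / p) * r ^ (-(n / p)) *
      ((unitBallVolume n * ρ ^ (n : ℝ))⁻¹ * (∫⁻ x, gagliardo s p u x).toReal) ^ (1 / p) := by
    refine le_of_rpow_le (norm_nonneg _) hD0 hω hr (by positivity) hp0 ?_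
    have h := enorm_ballMean_sub_ballMean_rpow_le hu hloc hs hp a c hρ hr hD
    rw [volume_ball_eq c hr, volume_ball_eq a hρ, ← ENNReal.ofReal_inv_of_pos (by positivity),
      ← ENNReal.ofReal_inv_of_pos (by positivity),
      ENNReal.ofReal_rpow_of_nonneg hD0 (by positivity), ← ENNReal.ofReal_mul (by positivity),
      ← ENNReal.ofReal_mul (by positivity)] at h
    have := ENNReal.toReal_mono (ENNReal.mul_ne_top ENNReal.ofReal_ne_top hW) h
    rw [ENNReal.toReal_mul, ENNReal.toReal_ofReal (by positivity), ← ENNReal.toReal_rpow,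
      toReal_enorm] at this
    simp only [Real.rpow_natCast]
    refine this.trans (le_of_eq ?_)
    ring
  refine key.trans (le_of_eq ?_)
  rw [Real.mul_rpow (by positivity) (by positivity), Real.inv_rpow (by positivity),
    Real.mul_rpow (by positivity) (by positivity), ← Real.rpow_mul hρ.le, mul_inv,
    ← Real.rpow_neg hω.le, ← Real.rpow_neg hρ.le, mul_one_div]
  ring

theorem norm_sub_le_of_mem_ball {x c y : EuclideanSpace ℝ (Fin n)} {l r D : ℝ} (h : ‖x - c‖ ≤ l)
    (hD : l + r ≤ D) (hy : y ∈ Metric.ball c r) : ‖x - y‖ ≤ D := by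
  rw [mem_ball_iff_norm'] at hy
  linarith [norm_sub_le_norm_sub_add_norm_sub x c y]

theorem norm_sub_le_of_mem_ball_of_mem_ball {x a c y : EuclideanSpace ℝ (Fin n)} {l ρ r D : ℝ}
    (h : ‖a - c‖ ≤ l) (hD : l + ρ + r ≤ D) (hx : x ∈ Metric.ball a ρ) (hy : y ∈ Metric.ball c r) :
    ‖x - y‖ ≤ D := by
  rw [mem_ball_iff_norm] at hx
  exact norm_sub_le_of_mem_ball (l := l + ρ)
    (by linarith [norm_sub_le_norm_sub_add_norm_sub x a c]) hD hy

theorem norm_sub_ballMean_self_le (hu : Measurable u) (hloc : LocallyIntegrable u volume)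
    (hs : 0 < s) (hp : 1 ≤ p) (x : EuclideanSpace ℝ (Fin n)) {r : ℝ} (hr : 0 < r)
    (hG : gagliardo s p u x ≠ ∞) :
    ‖u x - ballMean u x r‖ ≤ unitBallVolume n ^ (-(1 / p)) *
      (r ^ s * (gagliardo s p u x).toReal ^ (1 / p)) := by
  refine (norm_sub_ballMean_le hu hloc hs hp x x hr hr.le
    (fun y hy => norm_sub_le_of_mem_ball (l := 0) (by simp) (by simp) hy) hG).trans (le_of_eq ?_)
  have : r ^ (s + n / p) * r ^ (-(n / p)) = r ^ s := by
    rw [← Real.rpow_add hr]; congr 1; ring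
  rw [← this]; ring

/-- Pointwise Hardy inequality. -/
theorem norm_le_of_ballMean_eq_zero (hu : Measurable u) (hloc : LocallyIntegrable u volume)
    (hs : 0 < s) (hp : 1 ≤ p) {x z : EuclideanSpace ℝ (Fin n)} {d η : ℝ} (hd : 0 < d) (hη : 1 ≤ η)
    (hxz : ‖x - z‖ ≤ 2 * d) (hz : ballMean u z (d / η) = 0) (hG : gagliardo s p u x ≠ ∞) :
    ‖u x‖ ≤ unitBallVolume n ^ (-(1 / p)) * 3 ^ (s + n / p) *
      (η ^ (n / p) * d ^ s * (gagliardo s p u x).toReal ^ (1 / p)) := by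
  have hη0 : 0 < η := by linarith
  have hp0 : 0 < p := by linarith
  have hdη : d / η ≤ d := div_le_self hd.le hη
  -- `3 * d` is the distance `2 * d` to the centre plus a radius at most `d`. The small radius `d /
  -- η` produces the factor `η^(n/p)`.
  have h := norm_sub_ballMean_le hu hloc hs hp x z (div_pos hd hη0) (D := 3 * d) (by positivity)
    (fun y hy => norm_sub_le_of_mem_ball hxz (by linarith) hy) hG
  rw [hz, sub_zero] at h
  refine h.trans (le_of_eq ?_)
  rw [Real.mul_rpow (by norm_num) hd.le, Real.div_rpow hd.le hη0.le, Real.rpow_neg hη0.le,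
    div_inv_eq_mul]
  have : d ^ (s + n / p) * d ^ (-(n / p)) = d ^ s := by
    rw [← Real.rpow_add hd]; congr 1; ring
  rw [← this]; ring

/-! ### Chains of concentric balls -/

/-- By Jensen, the mean is at most the `L^p` norm times the volume to the power `-1/p`. -/
theorem tendsto_ballMean_atTop (hn : n ≠ 0) (hu : Measurable u) (hp : 1 ≤ p)
    (hup : ∫⁻ x, ‖u x‖ₑ ^ p ≠ ∞) (c : EuclideanSpace ℝ (Fin n)) :
    Filter.Tendsto (fun r => ballMean u c r) Filter.atTop (nhds 0) := by
  have hp0 : 0 < p := by linarith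
  have hω := unitBallVolume_pos n
  have h1 : Filter.Tendsto (fun r : ℝ => ((unitBallVolume n * r ^ n)⁻¹ *
      (∫⁻ x, ‖u x‖ₑ ^ p).toReal) ^ (1 / p)) Filter.atTop (nhds 0) := by
    have h2 : Filter.Tendsto (fun r : ℝ => (unitBallVolume n * r ^ n)⁻¹ *
      (∫⁻ x, ‖u x‖ₑ ^ p).toReal) Filter.atTop (nhds (0 * (∫⁻ x, ‖u x‖ₑ ^ p).toReal)) :=
      (((Filter.tendsto_pow_atTop hn).const_mul_atTop hω).inv_tendsto_atTop).mul_const _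
    rw [zero_mul] at h2
    have h3 := h2.rpow_const (p := 1 / p) (Or.inr (by positivity))
    rwa [Real.zero_rpow (by positivity)] at h3
  refine squeeze_zero_norm' ?_ h1
  filter_upwards [Filter.eventually_gt_atTop 0] with r hr
  have h := enorm_ballMean_rpow_le hu hp c hr
  rw [volume_ball_eq c hr, ← ENNReal.ofReal_inv_of_pos (by positivity)] at h
  have h4 := ENNReal.toReal_mono (ENNReal.mul_ne_top ENNReal.ofReal_ne_top hup) h
  rw [ENNReal.toReal_mul, ENNReal.toReal_ofReal (by positivity), ← ENNReal.toReal_rpow,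
      toReal_enorm] at h4
  rw [← Real.rpow_le_rpow_iff (norm_nonneg _) (by positivity) hp0, ← Real.rpow_mul (by positivity),
    one_div_mul_cancel hp0.ne', Real.rpow_one]
  exact h4

/-- Telescoping over balls of doubling radii, for `s p < n`. -/
theorem norm_ballMean_le_of_lt (hn : n ≠ 0) (hu : Measurable u)
    (hloc : LocallyIntegrable u volume) (hs : 0 < s) (hp : 1 ≤ p) (hsp : s < n / p)
    (hup : ∫⁻ x, ‖u x‖ₑ ^ p ≠ ∞) (hW : ∫⁻ x, gagliardo s p u x ≠ ∞)
    (c : EuclideanSpace ℝ (Fin n)) {r : ℝ} (hr : 0 < r) :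
    ‖ballMean u c r‖ ≤ (unitBallVolume n ^ (-(1 / p))) ^ 2 * 3 ^ (s + n / p) * 2 ^ (-(n / p)) /
      (1 - 2 ^ (s - n / p)) *
      (r ^ (s - n / p) * (∫⁻ x, gagliardo s p u x).toReal ^ (1 / p)) := by
  have hlt : (2 : ℝ) ^ (s - n / p) < 1 :=
    Real.rpow_lt_one_of_one_lt_of_neg one_lt_two (by linarith)
  have hlim : Filter.Tendsto (fun m : ℕ => ballMean u c (2 ^ m * r)) Filter.atTop (nhds 0) :=
    (tendsto_ballMean_atTop hn hu hp hup c).comp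
      ((tendsto_pow_atTop_atTop_of_one_lt one_lt_two).atTop_mul_const hr)
  have h := dist_le_of_le_geometric_of_tendsto₀ ((2 : ℝ) ^ (s - n / p))
    ((unitBallVolume n ^ (-(1 / p))) ^ 2 * 3 ^ (s + n / p) * 2 ^ (-(n / p)) *
      (r ^ (s - n / p) * (∫⁻ x, gagliardo s p u x).toReal ^ (1 / p))) hlt (fun m => ?_) hlim
  · rw [dist_zero_right, pow_zero, one_mul] at h
    refine h.trans (le_of_eq (by ring))
  · set ρ := 2 ^ m * r with hρ
    have hρ0 : 0 < ρ := by positivity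
    rw [dist_eq_norm, show 2 ^ (m + 1) * r = 2 * ρ by rw [hρ]; ring]
    refine (norm_ballMean_sub_ballMean_le hu hloc hs hp c c hρ0 (by positivity) (D := 3 * ρ)
      (by positivity) (fun x hx y hy => norm_sub_le_of_mem_ball_of_mem_ball (l := 0) (by simp)
        (by linarith) hx hy) hW).trans (le_of_eq ?_)
    have e1 : ρ ^ (s + n / p) * ρ ^ (-(n / p)) * ρ ^ (-(n / p)) = ρ ^ (s - n / p) := by
      rw [← Real.rpow_add hρ0, ← Real.rpow_add hρ0]; congr 1; ring
    have e2 : ρ ^ (s - n / p) = ((2 : ℝ) ^ (s - n / p)) ^ m * r ^ (s - n / p) := by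
      rw [hρ, Real.mul_rpow (by positivity) hr.le, ← Real.rpow_natCast, ← Real.rpow_natCast,
        ← Real.rpow_mul (by norm_num), ← Real.rpow_mul (by norm_num), mul_comm (m : ℝ)]
    rw [Real.mul_rpow (by norm_num) hρ0.le, Real.mul_rpow (by norm_num) hρ0.le]
    rw [e2] at e1
    linear_combination ((unitBallVolume n ^ (-(1 / p))) ^ 2 * 3 ^ (s + n / p) * 2 ^ (-(n / p)) *
      (∫⁻ x, gagliardo s p u x).toReal ^ (1 / p)) * e1

/-- Comparison of concentric means by `N` steps of equal ratio, for `s p ≥ n`. -/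
theorem norm_ballMean_sub_ballMean_self_le (hu : Measurable u)
    (hloc : LocallyIntegrable u volume) (hs : 0 < s) (hp : 1 ≤ p) (hsp : n / p ≤ s)
    (hW : ∫⁻ x, gagliardo s p u x ≠ ∞) (c : EuclideanSpace ℝ (Fin n)) {r R : ℝ} (hr : 0 < r)
    (hrR : r ≤ R) {N : ℕ} (hN : N ≠ 0) :
    ‖ballMean u c r - ballMean u c R‖ ≤ N * ((unitBallVolume n ^ (-(1 / p))) ^ 2 *
      2 ^ (s + n / p)) * ((R / r) ^ (n / p / N) * R ^ (s - n / p) *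
        (∫⁻ x, gagliardo s p u x).toReal ^ (1 / p)) := by
  have hω := unitBallVolume_pos n
  have hp0 : 0 < p := by linarith
  have hR : 0 < R := by linarith
  have hN0 : (0 : ℝ) < N := by positivity
  have h1 : 1 ≤ R / r := (one_le_div hr).2 hrR
  -- Each of the `N` steps enlarges the radius by `l` and costs `l^(n/p) = (R/r)^(n/(pN))`.
  set l : ℝ := (R / r) ^ (1 / (N : ℝ)) with hl
  have hl1 : 1 ≤ l := Real.one_le_rpow h1 (by positivity)
  have hl0 : 0 < l := by linarith
  have hlN : l ^ N * r = R := by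
    rw [hl, ← Real.rpow_natCast, ← Real.rpow_mul (by positivity), one_div_mul_cancel hN0.ne',
      Real.rpow_one]
    field_simp
  have hlν : l ^ (n / p : ℝ) = (R / r) ^ (n / p / N : ℝ) := by
    rw [hl, ← Real.rpow_mul (by positivity)]; congr 1; ring
  have h := dist_le_range_sum_of_dist_le (f := fun m : ℕ => ballMean u c (l ^ m * r)) N
    (d := fun _ => (unitBallVolume n ^ (-(1 / p))) ^ 2 * 2 ^ (s + n / p) *
      (l ^ (n / p : ℝ) * R ^ (s - n / p) * (∫⁻ x, gagliardo s p u x).toReal ^ (1 / p)))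
    (fun {k} hk => ?_)
  · simp only [pow_zero, one_mul, hlN, Finset.sum_const, Finset.card_range, nsmul_eq_mul] at h
    rw [dist_eq_norm, hlν] at h
    exact h.trans (le_of_eq (by ring))
  · set ρ := l ^ k * r with hρ
    have hρ0 : 0 < ρ := by positivity
    have hρR : l * ρ ≤ R := by
      rw [hρ, ← mul_assoc, ← pow_succ', ← hlN]
      gcongr
      exact hk
    have hρl : ρ ≤ l * ρ := le_mul_of_one_le_left hρ0.le hl1
    rw [dist_eq_norm, show l ^ (k + 1) * r = l * ρ by rw [hρ]; ring]
    refine (norm_ballMean_sub_ballMean_le hu hloc hs hp c c hρ0 (by positivity) (D := 2 * (l * ρ))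
      (by positivity) (fun x hx y hy => norm_sub_le_of_mem_ball_of_mem_ball (l := 0) (by simp)
        (by linarith) hx hy) hW).trans ?_
    have e1 : (l * ρ) ^ (s + n / p) * ρ ^ (-(n / p : ℝ)) * (l * ρ) ^ (-(n / p : ℝ)) =
        l ^ (n / p : ℝ) * (l * ρ) ^ (s - n / p) := by
      have : ρ ^ (-(n / p : ℝ)) = l ^ (n / p : ℝ) * (l * ρ) ^ (-(n / p : ℝ)) := by
        rw [Real.mul_rpow hl0.le hρ0.le, ← mul_assoc, ← Real.rpow_add hl0]; simp
      have e : (l * ρ) ^ (s + n / p) * (l * ρ) ^ (-(n / p : ℝ)) * (l * ρ) ^ (-(n / p : ℝ)) =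
          (l * ρ) ^ (s - n / p) := by
        rw [← Real.rpow_add (by positivity), ← Real.rpow_add (by positivity)]; congr 1; ring
      rw [this, ← e]; ring
    -- As `s ≥ n / p`, every step is controlled by the largest radius.
    have e2 : (l * ρ) ^ (s - n / p) ≤ R ^ (s - n / p) := by
      gcongr
    calc _ = (unitBallVolume n ^ (-(1 / p))) ^ 2 * 2 ^ (s + n / p) *
          (l ^ (n / p : ℝ) * (l * ρ) ^ (s - n / p) *
            (∫⁻ x, gagliardo s p u x).toReal ^ (1 / p)) := by
          rw [Real.mul_rpow (by norm_num) (by positivity : 0 ≤ l * ρ), ← e1]; ring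
      _ ≤ _ := by gcongr

end

/-! ### The pointwise interpolation bound -/

section
variable {n : ℕ} {s p : ℝ} {u : EuclideanSpace ℝ (Fin n) → ℂ}

theorem norm_le_of_lt (hn : n ≠ 0) (hu : Measurable u)
    (hloc : LocallyIntegrable u volume) (hs : 0 < s) (hp : 1 ≤ p) (hsp : s < n / p)
    (hup : ∫⁻ x, ‖u x‖ₑ ^ p ≠ ∞) (hW : ∫⁻ x, gagliardo s p u x ≠ ∞)
    {x : EuclideanSpace ℝ (Fin n)} (hG : gagliardo s p u x ≠ ∞) {r : ℝ} (hr : 0 < r) :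
    ‖u x‖ ≤ (unitBallVolume n ^ (-(1 / p)) +
      (unitBallVolume n ^ (-(1 / p))) ^ 2 * 3 ^ (s + n / p) * 2 ^ (-(n / p)) /
        (1 - 2 ^ (s - n / p))) *
      (r ^ s * (gagliardo s p u x).toReal ^ (1 / p) +
        r ^ (s - n / p) * (∫⁻ x, gagliardo s p u x).toReal ^ (1 / p)) := by
  have hω := unitBallVolume_pos n
  have hlt : (2 : ℝ) ^ (s - n / p) < 1 :=
    Real.rpow_lt_one_of_one_lt_of_neg one_lt_two (by linarith)
  have h1 := norm_sub_ballMean_self_le hu hloc hs hp x hr hG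
  have h2 := norm_ballMean_le_of_lt hn hu hloc hs hp hsp hup hW x hr
  have h3 := norm_le_norm_sub_add (u x) (ballMean u x r)
  set B := (unitBallVolume n ^ (-(1 / p))) ^ 2 * 3 ^ (s + n / p) * 2 ^ (-(n / p)) /
    (1 - 2 ^ (s - n / p))
  have hB : 0 ≤ B := div_nonneg (by positivity) (by linarith)
  set A := unitBallVolume n ^ (-(1 / p))
  set γ := r ^ s * (gagliardo s p u x).toReal ^ (1 / p)
  set w := r ^ (s - n / p) * (∫⁻ x, gagliardo s p u x).toReal ^ (1 / p)
  have hA : 0 ≤ A := by positivity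
  have hγ : 0 ≤ γ := by positivity
  have hw : 0 ≤ w := by positivity
  nlinarith [mul_nonneg hA hw, mul_nonneg hB hγ]

/-- The chain is `x`, `B(x, d/t)`, `B(x, d)`, `B(z, d)`, `B(z, d/η)`, and the last mean is zero.
Only the first link uses the local quotient at `x`; the others use the global seminorm. -/
theorem norm_le_of_le (hu : Measurable u)
    (hloc : LocallyIntegrable u volume) (hs : 0 < s) (hp : 1 ≤ p) (hsp : n / p ≤ s)
    (hW : ∫⁻ x, gagliardo s p u x ≠ ∞)
    {x z : EuclideanSpace ℝ (Fin n)} {d η : ℝ} (hd : 0 < d) (hη : 1 ≤ η)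
    (hxz : ‖x - z‖ ≤ 2 * d) (hz : ballMean u z (d / η) = 0) (hG : gagliardo s p u x ≠ ∞)
    {N : ℕ} (hN : N ≠ 0) {β : ℝ} (hβ : n / p / N ≤ β) {t : ℝ} (ht : 1 ≤ t) :
    ‖u x‖ ≤ (unitBallVolume n ^ (-(1 / p)) +
      (N * ((unitBallVolume n ^ (-(1 / p))) ^ 2 * 2 ^ (s + n / p)) * 2 +
      (unitBallVolume n ^ (-(1 / p))) ^ 2 * 4 ^ (s + n / p))) *
      ((d / t) ^ s * (gagliardo s p u x).toReal ^ (1 / p) +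
        η ^ β * t ^ β * d ^ (s - n / p) * (∫⁻ x, gagliardo s p u x).toReal ^ (1 / p)) := by
  have hω := unitBallVolume_pos n
  have hη0 : 0 < η := by linarith
  have ht0 : 0 < t := by linarith
  have hp0 : 0 < p := by linarith
  have hβ0 : 0 ≤ β := le_trans (by positivity) hβ
  have h1 := norm_sub_ballMean_self_le hu hloc hs hp x (div_pos hd ht0) hG
  have h2 := norm_ballMean_sub_ballMean_self_le hu hloc hs hp hsp hW x (div_pos hd ht0)
    (div_le_self hd.le ht) hN
  have h3 := norm_ballMean_sub_ballMean_le hu hloc hs hp x z hd hd (D := 4 * d) (by positivity)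
    (fun a ha y hy => norm_sub_le_of_mem_ball_of_mem_ball hxz (by linarith) ha hy) hW
  have h4 := norm_ballMean_sub_ballMean_self_le hu hloc hs hp hsp hW z (div_pos hd hη0)
    (div_le_self hd.le hη) hN
  rw [hz, zero_sub, norm_neg] at h4
  rw [div_div_cancel₀ hd.ne'] at h2 h4
  set A := unitBallVolume n ^ (-(1 / p))
  set w := (∫⁻ x, gagliardo s p u x).toReal ^ (1 / p)
  set B := N * (A ^ 2 * 2 ^ (s + n / p))
  have hw : 0 ≤ w := by positivity
  have hA : 0 ≤ A := by positivity
  have hB : 0 ≤ B := by positivity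
  have ht1 : 1 ≤ t ^ β := Real.one_le_rpow ht hβ0
  have hη1 : 1 ≤ η ^ β := Real.one_le_rpow hη hβ0
  have ht2 : t ^ (n / p / N : ℝ) ≤ t ^ β := Real.rpow_le_rpow_of_exponent_le ht hβ
  have hη2 : η ^ (n / p / N : ℝ) ≤ η ^ β := Real.rpow_le_rpow_of_exponent_le hη hβ
  set v := η ^ β * t ^ β * d ^ (s - n / p) * w with hv
  have hv0 : 0 ≤ v := by positivity
  have h2' : ‖ballMean u x (d / t) - ballMean u x d‖ ≤ B * v := by
    refine h2.trans ?_
    rw [hv]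
    gcongr
    exact ht2.trans (le_mul_of_one_le_left (by positivity) hη1)
  have h4' : ‖ballMean u z d‖ ≤ B * v := by
    refine h4.trans ?_
    rw [hv]
    gcongr
    exact hη2.trans (le_mul_of_one_le_right (by positivity) ht1)
  have h3' : ‖ballMean u x d - ballMean u z d‖ ≤ A ^ 2 * 4 ^ (s + n / p) * v := by
    refine h3.trans ?_
    have e : d ^ (s + n / p) * d ^ (-(n / p)) * d ^ (-(n / p)) = d ^ (s - n / p) := by
      rw [← Real.rpow_add hd, ← Real.rpow_add hd]; congr 1; ring
    calc _ = A ^ 2 * 4 ^ (s + n / p) * (1 * d ^ (s - n / p) * w) := by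
          rw [Real.mul_rpow (by norm_num) hd.le, ← e]; ring
      _ ≤ _ := by
          rw [hv]; gcongr; exact one_le_mul_of_one_le_of_one_le hη1 ht1
  have h5 : ‖u x‖ ≤ ‖u x - ballMean u x (d / t)‖ + ‖ballMean u x (d / t) - ballMean u x d‖ +
      ‖ballMean u x d - ballMean u z d‖ + ‖ballMean u z d‖ := by
    linarith [norm_le_norm_sub_add (u x) (ballMean u x (d / t)),
      norm_le_norm_sub_add (ballMean u x (d / t)) (ballMean u x d),
      norm_le_norm_sub_add (ballMean u x d) (ballMean u z d)]
  set γ := (d / t) ^ s * (gagliardo s p u x).toReal ^ (1 / p)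
  have hγ : 0 ≤ γ := by positivity
  set C := A ^ 2 * 4 ^ (s + n / p)
  have hC : 0 ≤ C := by positivity
  nlinarith [mul_nonneg hA hv0, mul_nonneg hB hγ, mul_nonneg hC hγ]

theorem exists_forall_norm_le (hn : n ≠ 0) (hs : 0 < s) (hp : 1 ≤ p) {κ θ : ℝ} (hκ0 : 0 < κ)
    (hκ1 : κ < 1) (hθ : θ = s - n / p + n / p * κ) (hθ0 : 0 < θ) :
    ∃ K : ℝ, 0 < K ∧ ∀ u : EuclideanSpace ℝ (Fin n) → ℂ, Measurable u →
      LocallyIntegrable u volume → ∫⁻ x, ‖u x‖ₑ ^ p ≠ ∞ → ∫⁻ x, gagliardo s p u x ≠ ∞ →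
      ∫⁻ x, gagliardo s p u x ≠ 0 → ∀ x z : EuclideanSpace ℝ (Fin n), ∀ d η : ℝ, 0 < d → 1 ≤ η →
      ‖x - z‖ ≤ 2 * d → ballMean u z (d / η) = 0 → gagliardo s p u x ≠ ∞ →
      ‖u x‖ ≤ K * (η ^ (n / p * κ + θ) * d ^ θ * ((gagliardo s p u x).toReal ^ (1 / p)) ^ κ *
        ((∫⁻ x, gagliardo s p u x).toReal ^ (1 / p)) ^ (1 - κ)) := by
  have hω := unitBallVolume_pos n
  have hν : 0 < n / p := by positivity
  have hA : 0 < unitBallVolume n ^ (-(1 / p)) * 3 ^ (s + n / p) := by positivity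
  rcases lt_or_ge s (n / p) with hsp | hsp
  · have hlt : (2 : ℝ) ^ (s - n / p) < 1 :=
      Real.rpow_lt_one_of_one_lt_of_neg one_lt_two (by linarith)
    set B := unitBallVolume n ^ (-(1 / p)) +
      (unitBallVolume n ^ (-(1 / p))) ^ 2 * 3 ^ (s + n / p) * 2 ^ (-(n / p)) /
        (1 - 2 ^ (s - n / p)) with hB
    have hB0 : 0 ≤ B := add_nonneg (by positivity) (div_nonneg (by positivity) (by linarith))
    refine ⟨2 * (unitBallVolume n ^ (-(1 / p)) * 3 ^ (s + n / p) + B), by positivity, ?_⟩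
    intro u hu hloc hup hW hW0 x z d η hd hη hxz hz hG
    refine le_of_forall_scale_le (by positivity) hη hd (by positivity)
      (Real.rpow_pos_of_pos (ENNReal.toReal_pos hW0 hW) _) (norm_nonneg _) hν hκ0 hκ1 hθ hθ0 ?_ ?_
    · refine (norm_le_of_ballMean_eq_zero hu hloc hs hp hd hη hxz hz hG).trans ?_
      gcongr; linarith
    · intro r hr
      refine (norm_le_of_lt hn hu hloc hs hp hsp hup hW hG hr).trans ?_
      rw [← hB]
      gcongr; linarith
  -- `N` makes `n / (p N)` at most `β = min θ (s κ)`, the largest loss that the balancing lemma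
  -- tolerates.
  · obtain ⟨N, hN⟩ := exists_nat_gt (n / p / min θ (s * κ))
    have hβ : 0 < min θ (s * κ) := lt_min hθ0 (by positivity)
    have hN0 : (0 : ℝ) < N := lt_trans (by positivity) hN
    have hN1 : n / p / N ≤ min θ (s * κ) := by
      rw [div_lt_iff₀ hβ] at hN
      rw [div_le_iff₀ hN0]; linarith
    set B := unitBallVolume n ^ (-(1 / p)) +
      (N * ((unitBallVolume n ^ (-(1 / p))) ^ 2 * 2 ^ (s + n / p)) * 2 +
      (unitBallVolume n ^ (-(1 / p))) ^ 2 * 4 ^ (s + n / p)) with hB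
    have hB0 : 0 ≤ B := by positivity
    refine ⟨2 * (unitBallVolume n ^ (-(1 / p)) * 3 ^ (s + n / p) + B), by positivity, ?_⟩
    intro u hu hloc hup hW hW0 x z d η hd hη hxz hz hG
    refine le_of_forall_small_scale_le (β := min θ (s * κ)) (by positivity) hη hd (by positivity)
      (Real.rpow_pos_of_pos (ENNReal.toReal_pos hW0 hW) _) (norm_nonneg _) hν hκ0 hκ1 hs hθ hθ0
      (min_le_left _ _) (min_le_right _ _) ?_ ?_
    · refine (norm_le_of_ballMean_eq_zero hu hloc hs hp hd hη hxz hz hG).trans ?_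
      gcongr; linarith
    · intro t ht
      have hη0 : 0 < η := by linarith
      refine (norm_le_of_le hu hloc hs hp hsp hW hd hη hxz hz hG
        (Nat.cast_pos.1 hN0).ne' hN1 ht).trans ?_
      rw [← hB]
      gcongr; linarith

end

/-! ### Geometry of the domain and integration -/

section
variable {n : ℕ} {s p : ℝ} {u : EuclideanSpace ℝ (Fin n) → ℂ}

/-- Plumpness is applied at a boundary point nearest to `x`, with radius `d`. This radius is
admissible because the complement of a bounded set has infinite diameter. -/
theorem IsPlump.exists_ball_subset_compl (hn : n ≠ 0) {η : ℝ}
    {Ω : Set (EuclideanSpace ℝ (Fin n))} (hΩo : IsOpen Ω) (hΩb : Bornology.IsBounded Ω)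
    (hΩ : IsPlump η Ωᶜ) {x : EuclideanSpace ℝ (Fin n)} (hx : x ∈ Ω) :
    ∃ z d, 0 < d ∧ Metric.infEDist x (frontier Ω) = ENNReal.ofReal d ∧ ‖x - z‖ ≤ 2 * d ∧
      Metric.ball z (d / η) ⊆ Ωᶜ := by
  have : Nonempty (Fin n) := ⟨⟨0, Nat.pos_of_ne_zero hn⟩⟩
  have hunb : ¬ Bornology.IsBounded (Set.univ : Set (EuclideanSpace ℝ (Fin n))) :=
    NormedSpace.unbounded_univ ℝ _
  have hne : Ω ≠ Set.univ := fun h => hunb (h ▸ hΩb)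
  have hfr : (frontier Ω).Nonempty := nonempty_frontier_iff.2 ⟨⟨x, hx⟩, hne⟩
  have hxf : x ∉ frontier Ω := fun h => by
    rw [hΩo.frontier_eq] at h; exact h.2 hx
  have hfin := Metric.infEDist_ne_top (x := x) hfr
  obtain ⟨a, ha, hax⟩ := isClosed_frontier.exists_infDist_eq_dist hfr x
  have hd : 0 < Metric.infDist x (frontier Ω) :=
    (isClosed_frontier.notMem_iff_infDist_pos hfr).1 hxf
  have hdiam : Metric.ediam Ωᶜ = ∞ := by
    by_contra h
    have h1 : Bornology.IsBounded Ωᶜ := Metric.isBounded_iff_ediam_ne_top.2 h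
    exact hunb (by simpa using hΩb.union h1)
  obtain ⟨z, hz, hzs⟩ := hΩ a (by rw [← frontier_compl] at ha; exact ha.1) _ hd
    (hdiam ▸ ENNReal.ofReal_lt_top)
  refine ⟨z, _, hd, (ENNReal.ofReal_toReal hfin).symm, ?_, hzs⟩
  have h2 := norm_sub_le_norm_sub_add_norm_sub x a z
  rw [mem_closedBall_iff_norm'] at hz
  rw [dist_eq_norm] at hax
  linarith

theorem fracSobolevSeminorm_eq_of_ae_eq {v : EuclideanSpace ℝ (Fin n) → ℂ}
    (h : u =ᵐ[volume] v) :
    fracSobolevSeminorm s p u = (∫⁻ x, gagliardo s p v x) ^ (1 / p) := by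
  unfold fracSobolevSeminorm gagliardo
  congr 1
  refine lintegral_congr_ae ?_
  filter_upwards [h] with y hy
  refine lintegral_congr_ae ?_
  filter_upwards [h] with x hx
  -- The seminorm has `y` as its outer variable, `gagliardo` its first; the kernel is symmetric.
  rw [hx, hy, enorm_sub_rev, enorm_sub_rev x y]

/-- With `κ = p / q` the `q`-th power turns the local factor into exactly `G`, which makes the bound
integrable. -/
theorem enorm_rpow_div_le {q K η θ κ E d : ℝ} (hp : 0 < p) (hq : 0 < q) (hK : 0 < K)
    (hη : 1 ≤ η) (hd : 0 < d) (hκ : κ = p / q) {G W : ℝ≥0∞} (hG : G ≠ ∞) {a : ℂ}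
    (h : ‖a‖ ≤ K * (η ^ E * d ^ θ * (G.toReal ^ (1 / p)) ^ κ * (W.toReal ^ (1 / p)) ^ (1 - κ))) :
    ‖a‖ₑ ^ q / ENNReal.ofReal d ^ (θ * q) ≤
      ENNReal.ofReal ((K * η ^ E) ^ q * (W.toReal ^ (1 / p)) ^ (q - p)) * G := by
  have hη0 : 0 < η := by linarith
  have h1 : ‖a‖ ^ q ≤ ((K * η ^ E) ^ q * (W.toReal ^ (1 / p)) ^ (q - p)) * G.toReal *
      d ^ (θ * q) := by
    refine (Real.rpow_le_rpow (norm_nonneg _) h hq.le).trans (le_of_eq ?_)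
    have e1 : ((G.toReal ^ (1 / p)) ^ κ) ^ q = G.toReal := by
      rw [← Real.rpow_mul (by positivity), ← Real.rpow_mul (by positivity), hκ,
        show 1 / p * (p / q * q) = 1 by field_simp, Real.rpow_one]
    have e2 : ((W.toReal ^ (1 / p)) ^ (1 - κ)) ^ q = (W.toReal ^ (1 / p)) ^ (q - p) := by
      rw [← Real.rpow_mul (by positivity), hκ]; congr 1; field_simp
    rw [← mul_assoc, ← mul_assoc, ← mul_assoc, Real.mul_rpow (by positivity) (by positivity),
      Real.mul_rpow (by positivity) (by positivity), Real.mul_rpow (by positivity) (by positivity),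
      e1, e2, ← Real.rpow_mul hd.le]
    ring
  refine ENNReal.div_le_of_le_mul ?_
  rw [← ofReal_norm, ENNReal.ofReal_rpow_of_nonneg (norm_nonneg _) hq.le,
    ENNReal.ofReal_rpow_of_pos hd]
  conv_rhs => rw [← ENNReal.ofReal_toReal hG]
  rw [← ENNReal.ofReal_mul (by positivity), ← ENNReal.ofReal_mul (by positivity)]
  exact ENNReal.ofReal_le_ofReal h1

/-- The fractional Hardy–Sobolev inequality for a measurable function vanishing off `closure Ω`. -/
theorem exists_forall_hardySobolev (hn : n ≠ 0) (hs : 0 < s) (hp : 1 < p) {q : ℝ} (hpq : p < q)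
    (hθ : 0 < s - n / p + n / q) :
    ∃ K : ℝ, 0 < K ∧ ∀ η : ℝ, 1 ≤ η → ∀ Ω : Set (EuclideanSpace ℝ (Fin n)), IsOpen Ω →
      Bornology.IsBounded Ω → IsPlump η Ωᶜ → ∀ u : EuclideanSpace ℝ (Fin n) → ℂ, Measurable u →
      LocallyIntegrable u volume → ∫⁻ x, ‖u x‖ₑ ^ p ≠ ∞ → ∫⁻ x, gagliardo s p u x ≠ ∞ →
      (∀ᵐ x ∂volume, x ∉ closure Ω → u x = 0) →
      (∫⁻ x in Ω, ‖u x‖ₑ ^ q /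
          Metric.infEDist x (frontier Ω) ^ (s * q + n * (1 - q / p))) ^ (1 / q) ≤
        ENNReal.ofReal (K * η ^ (2 * n / q + s - n / p)) *
          (∫⁻ x, gagliardo s p u x) ^ (1 / p) := by
  have hp0 : 0 < p := by linarith
  have hq0 : 0 < q := by linarith
  have hκ1 : p / q < 1 := (div_lt_one hq0).2 hpq
  have hνκ : n / p * (p / q) = n / q := by field_simp
  obtain ⟨K, hK, H⟩ := exists_forall_norm_le (s := s) hn hs hp.le (κ := p / q)
    (θ := s - n / p + n / q) (by positivity) hκ1 (by rw [hνκ]) hθ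
  refine ⟨K, hK, fun η hη Ω hΩo hΩb hΩ u hu hloc hup hW hsupp => ?_⟩
  have hη0 : 0 < η := by linarith
  have hE : 2 * n / q + s - n / p = n / p * (p / q) + (s - n / p + n / q) := by
    rw [hνκ]; ring
  have hwt : s * q + n * (1 - q / p) = (s - n / p + n / q) * q := by field_simp; ring
  have hmean : ∀ z r, Metric.ball z r ⊆ Ωᶜ → ballMean u z r = 0 := fun z r hz => by
    refine ballMean_eq_zero ?_
    filter_upwards [hsupp] with y hy hyb
    -- An open ball that misses `Ω` also misses `closure Ω`, so `u` vanishes almost everywhere on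
    -- it.
    have hdisj : Disjoint (Metric.ball z r) (closure Ω) :=
      (Set.disjoint_left.2 fun a ha => hz ha).closure_right Metric.isOpen_ball
    exact hy (Set.disjoint_left.1 hdisj hyb)
  have hGm := measurable_gagliardo (s := s) (p := p) hu
  have hGae : ∀ᵐ x ∂volume, gagliardo s p u x ≠ ∞ := by
    filter_upwards [ae_lt_top hGm hW] with x hx using hx.ne
  have hpt : ∀ᵐ x ∂volume, x ∈ Ω →
      ‖u x‖ₑ ^ q / Metric.infEDist x (frontier Ω) ^ (s * q + n * (1 - q / p)) ≤
      ENNReal.ofReal ((K * η ^ (2 * n / q + s - n / p)) ^ q *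
        ((∫⁻ x, gagliardo s p u x).toReal ^ (1 / p)) ^ (q - p)) * gagliardo s p u x := by
    rcases eq_or_ne (∫⁻ x, gagliardo s p u x) 0 with hW0 | hW0
    -- With zero seminorm there is no critical scale, but the Hardy bound gives `u x = 0` directly.
    · filter_upwards [(lintegral_eq_zero_iff hGm).1 hW0] with x hx hxΩ
      obtain ⟨z, d, hd, hdx, hxz, hzs⟩ := hΩ.exists_ball_subset_compl hn hΩo hΩb hxΩ
      have h0 : gagliardo s p u x = 0 := hx
      have h := norm_le_of_ballMean_eq_zero hu hloc hs hp.le hd hη hxz (hmean _ _ hzs)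
        (h0 ▸ ENNReal.zero_ne_top)
      rw [h0, ENNReal.toReal_zero, Real.zero_rpow (by positivity), mul_zero, mul_zero] at h
      have hux : u x = 0 := norm_le_zero_iff.1 h
      simp [hux, ENNReal.zero_rpow_of_pos hq0]
    · filter_upwards [hGae] with x hx hxΩ
      obtain ⟨z, d, hd, hdx, hxz, hzs⟩ := hΩ.exists_ball_subset_compl hn hΩo hΩb hxΩ
      rw [hdx, hwt, hE]
      exact enorm_rpow_div_le hp0 hq0 hK hη hd rfl hx
        (H u hu hloc hup hW hW0 x z d η hd hη hxz (hmean _ _ hzs) hx)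
  set M := K * η ^ (2 * n / q + s - n / p) with hM
  have hM0 : 0 < M := by positivity
  calc _ ≤ (∫⁻ x in Ω, ENNReal.ofReal (M ^ q *
        ((∫⁻ x, gagliardo s p u x).toReal ^ (1 / p)) ^ (q - p)) * gagliardo s p u x) ^ (1 / q) := by
        refine ENNReal.rpow_le_rpow (lintegral_mono_ae ?_) (by positivity)
        exact (ae_restrict_iff' hΩo.measurableSet).2 hpt
    _ ≤ (∫⁻ x, ENNReal.ofReal (M ^ q *
        ((∫⁻ x, gagliardo s p u x).toReal ^ (1 / p)) ^ (q - p)) * gagliardo s p u x) ^ (1 / q) :=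
        ENNReal.rpow_le_rpow (setLIntegral_le_lintegral _ _) (by positivity)
    _ = (ENNReal.ofReal (M ^ q *
        ((∫⁻ x, gagliardo s p u x).toReal ^ (1 / p)) ^ (q - p)) *
          ∫⁻ x, gagliardo s p u x) ^ (1 / q) := by rw [lintegral_const_mul _ hGm]
    _ = _ := by
        set W := ∫⁻ x, gagliardo s p u x
        have e : (W.toReal ^ (1 / p)) ^ (q - p) * W.toReal = (W.toReal ^ (1 / p)) ^ q := by
          rcases (ENNReal.toReal_nonneg (a := W)).eq_or_lt with h | h
          · rw [← h, mul_zero, Real.zero_rpow (by positivity), Real.zero_rpow hq0.ne']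
          · have e' : W.toReal = (W.toReal ^ (1 / p)) ^ p := by
              rw [← Real.rpow_mul h.le, one_div_mul_cancel hp0.ne', Real.rpow_one]
            nth_rw 2 [e']
            rw [← Real.rpow_add (by positivity), sub_add_cancel]
        rw [← ENNReal.ofReal_toReal hW, ENNReal.toReal_ofReal ENNReal.toReal_nonneg,
          ← ENNReal.ofReal_mul (by positivity), mul_assoc, e,
          ← Real.mul_rpow hM0.le (by positivity),
          ENNReal.ofReal_rpow_of_nonneg (by positivity) (by positivity),
          ENNReal.ofReal_rpow_of_nonneg (by positivity) (by positivity),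
          ← Real.rpow_mul (by positivity), mul_one_div_cancel hq0.ne', Real.rpow_one,
          ENNReal.ofReal_mul hM0.le]

end

theorem corollary4p1 (n : ℕ) (hn : 2 ≤ n) (s p q : ℝ) (hs0 : 0 < s) (hs1 : s < 1)
    (hp : 1 < p) (hq : 1 < q) (hpq0 : 0 < 1 / p - 1 / q) (hpq1 : 1 / p - 1 / q < s / n) :
    ∃ c : ℝ, 0 < c ∧
      ∀ (η : ℝ), 1 ≤ η →
      ∀ (Ω : Set (EuclideanSpace ℝ (Fin n))), IsOpen Ω → IsConnected Ω →
        Bornology.IsBounded Ω → IsPlump η Ωᶜ →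
      ∀ u : EuclideanSpace ℝ (Fin n) → ℂ, MemBesovTilde s p Ω u →
        (∫⁻ x in Ω, ‖u x‖ₑ ^ q /
            Metric.infEDist x (frontier Ω) ^ (s * q + n * (1 - q / p))) ^ (1 / q)
          ≤ ENNReal.ofReal (c * η ^ (2 * n / q + s - n / p)) * besovTildeNorm s p u := by
  have hp0 : 0 < p := by linarith
  have hq0 : 0 < q := by linarith
  have hn0 : (0 : ℝ) < n := by positivity
  have hpq : p < q := lt_of_one_div_lt_one_div hq0 (by linarith)
  have hθ : 0 < s - n / p + n / q := by
    rw [lt_div_iff₀ hn0] at hpq1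
    have : (1 / p - 1 / q) * n = n / p - n / q := by ring
    linarith
  obtain ⟨K, hK, H⟩ := exists_forall_hardySobolev (n := n) (by omega) hs0 hp hpq hθ
  refine ⟨K, hK, fun η hη Ω hΩo _ hΩb hΩ u ⟨⟨hu, hunorm⟩, v, hvu, hv⟩ => ?_⟩
  -- All the quantities are insensitive to null sets, so `u` is replaced by a measurable
  -- representative.
  have hw := hu.1.stronglyMeasurable_mk.measurable
  have huw := hu.1.ae_eq_mk
  set w := hu.1.mk u
  have hwLp : MemLp w (ENNReal.ofReal p) volume := hu.ae_eq huw
  have hsemi := fracSobolevSeminorm_eq_of_ae_eq (s := s) (p := p) huw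
  have hW : ∫⁻ x, gagliardo s p w x ≠ ∞ := by
    have h1 : fracSobolevSeminorm s p u ≠ ∞ := (le_add_self.trans_lt hunorm).ne
    rw [hsemi] at h1
    intro h
    rw [h, ENNReal.top_rpow_of_pos (by positivity)] at h1
    exact h1 rfl
  have hwp : ∫⁻ x, ‖w x‖ₑ ^ p ≠ ∞ := by
    have := lintegral_rpow_enorm_lt_top_of_eLpNorm_lt_top (by simpa using hp0)
      ENNReal.ofReal_ne_top hwLp.2
    rw [ENNReal.toReal_ofReal hp0.le] at this
    exact this.ne
  have hsupp : ∀ᵐ x ∂volume, x ∉ closure Ω → w x = 0 := by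
    filter_upwards [huw, hvu] with x hx hx' hxΩ
    rw [← hx, ← hx']
    exact image_eq_zero_of_notMem_tsupport fun h => hxΩ (hv h)
  have h := H η hη Ω hΩo hΩb hΩ w hw
    (hwLp.locallyIntegrable (by simpa using hp.le)) hwp hW hsupp
  have hint : ∫⁻ x in Ω, ‖u x‖ₑ ^ q /
        Metric.infEDist x (frontier Ω) ^ (s * q + n * (1 - q / p)) =
      ∫⁻ x in Ω, ‖w x‖ₑ ^ q /
        Metric.infEDist x (frontier Ω) ^ (s * q + n * (1 - q / p)) := by
    refine lintegral_congr_ae (ae_restrict_of_ae ?_)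
    filter_upwards [huw] with x hx
    rw [hx]
  rw [hint]
  refine h.trans (mul_le_mul' le_rfl ?_)
  rw [← hsemi]
  -- The seminorm alone controls the left side; the `L^p` part of the norm is added for free.
  exact le_add_self
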